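/- Let $\Omega\subset\mathbb R^n$ ($n\ge1$) be a bounded Lipschitz domain, $V:=H^1(\Omega)$ with its usual norm, $f\in L^2(\Omega)$, $h\in H^{1/2}(\partial\Omega)$, and $\psi\in H^1(\Omega)$ with $\psi\le h$ on $\partial\Omega$ in the sense of traces. Put $$K:=\{u\in V:\ u\ge\psi\ \text{a.e. in }\Omega,\ u=h\ \text{on }\partial\Omega\ \text{in the sense of traces}\}.$$ Let $A:V\to V^*$ be Lipschitz and coercive on $K$, i.e. there are constants $C_a,C_b>0$ with $$\|Au-Av\|_{V^*}\le C_b\|u-v\|_V,\qquad \langle Au-Av,u-v\rangle\ge C_a\|u-v\|_V^2\qquad\forall u,v\in K.$$ Consider the variational inequality $$\text{(VI)}\qquad u\in K:\quad \langle Au-f,u-v\rangle\le 0\quad\forall v\in K.$$ Let $u^*$ be a solution of (VI), and let $X,Y\subseteq V$ be sets such that $u^*\in X\cap Y$, $K\cap X\subseteq K\cap Y$, and $K\cap Y$ is convex and closed in $V$. Fix $\gamma>0$ and, for $u,v\in V$, set $$L_\gamma(u,v):=\langle Au-f,u-v\rangle-\tfrac1{2\gamma}\|u-v\|_V^2,\qquad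 G_\gamma(u):=\sup_{v\in K\cap Y}L_\gamma(u,v).$$ Then: (i) $G_\gamma(u)$ is finite for every $u\in V$. (ii) $G_\gamma(u)\ge0$ for every $u\in K\cap X$. (iii) For $u\in K\cap X$, $G_\gamma(u)=0$ if and only if $u$ solves (VI). (iv) $G_\gamma$ is lower semicontinuous on $K\cap X$, with the topology of $V$. (v) For every $u\in V$, $L_\gamma(u,\cdot)$ has exactly one maximiser over $K\cap Y$, and $G_\gamma(u)$ is the maximum. (vi) An element $u\in V$ solves (VI) if and only if $u\in K\cap X$ and $u$ minimises $G_\gamma$ over $K\cap X$. Equivalently, $u$ solves (VI) if and only if there is a $v$ such that $(u,v)$ is a solution of the minmax problem $\min_{u\in K\cap X}\max_{v\in K\cap Y}L_\gamma(u,v)$, i.e. $u\in K\cap X$, $v\in K\cap Y$, and $$L_\gamma(u,v')\le L_\gamma(u,v)\le\max_{\hat v\in K\cap Y}L_\gamma(u',\hat v)\qquad\forall u'\in K\cap X,\ v'\in K\cap Y.$$ -/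

import Mathlib

open MeasureTheory Set Filter Topology
open scoped ContDiff ENNReal

noncomputable section

namespace ObstacleVI

/-- The Euclidean space `ℝⁿ`. -/
abbrev E (n : ℕ) : Type := EuclideanSpace ℝ (Fin n)

/-- The `i`-th classical partial derivative of a function on `ℝⁿ`. -/
def partialDeriv {n : ℕ} (i : Fin n) (φ : E n → ℝ) (x : E n) : ℝ :=
  fderiv ℝ φ x (EuclideanSpace.single i (1 : ℝ))

/-- `Ω` is a bounded Lipschitz domain: a nonempty connected bounded open set which, near each of
its boundary points `x`, is the set of points lying strictly above the graph of a Lipschitz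
function. The graph is taken in the direction of some unit vector `ν`, over the hyperplane
orthogonal to `ν`. -/
structure IsBoundedLipschitzDomain {n : ℕ} (Ω : Set (E n)) : Prop where
  isOpen : IsOpen Ω
  isConnected : IsConnected Ω
  isBounded : Bornology.IsBounded Ω
  lipschitz_boundary : ∀ x ∈ frontier Ω, ∃ ν : E n, ‖ν‖ = 1 ∧ ∃ r : ℝ, 0 < r ∧
    ∃ (C : NNReal) (g : ↥((Submodule.span ℝ {ν})ᗮ) → ℝ), LipschitzWith C g ∧
      ∀ y ∈ Metric.ball x r,
        (y ∈ Ω ↔ g ((Submodule.span ℝ {ν})ᗮ.orthogonalProjectionOnto y) < inner ℝ ν y)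

/-- The real Lebesgue space `L²(Ω)`. -/
abbrev L2 {n : ℕ} (Ω : Set (E n)) : Type := Lp ℝ 2 (volume.restrict Ω)

/-- The surface measure on `∂Ω`: the `(n-1)`-dimensional Hausdorff measure restricted to `∂Ω`. -/
def surfaceMeasure {n : ℕ} (Ω : Set (E n)) : Measure (E n) :=
  (Measure.hausdorffMeasure ((n : ℝ) - 1)).restrict (frontier Ω)

/-- The real Lebesgue space `L²(∂Ω)`. -/
abbrev L2Boundary {n : ℕ} (Ω : Set (E n)) : Type := Lp ℝ 2 (surfaceMeasure Ω)

/-- `g` is the weak partial derivative of `u` on `Ω` in the `i`-th coordinate direction. -/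
def IsWeakPartialDeriv {n : ℕ} (Ω : Set (E n)) (i : Fin n) (u g : L2 Ω) : Prop :=
  ∀ φ : E n → ℝ, ContDiff ℝ ∞ φ → HasCompactSupport φ → tsupport φ ⊆ Ω →
    ∫ x in Ω, u x * partialDeriv i φ x = - ∫ x in Ω, g x * φ x

/-- The Hilbert space `L²(Ω) × L²(Ω)ⁿ`, with norm `(‖u‖² + ∑ᵢ ‖gᵢ‖²)^(1/2)`. -/
abbrev L2Pair {n : ℕ} (Ω : Set (E n)) : Type :=
  WithLp 2 (L2 Ω × PiLp 2 (fun _ : Fin n => L2 Ω))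

theorem integrable_mul_test {n : ℕ} {Ω : Set (E n)} (u : L2 Ω) {φ : E n → ℝ}
    (hφ : Continuous φ) (hc : HasCompactSupport φ) :
    Integrable (fun x => u x * φ x) (volume.restrict Ω) :=
  (Lp.memLp u).integrable_mul (q := 2) (hφ.memLp_of_hasCompactSupport hc)

theorem integrable_mul_partialDeriv {n : ℕ} {Ω : Set (E n)} (i : Fin n) (u : L2 Ω) {φ : E n → ℝ}
    (hφ : ContDiff ℝ ∞ φ) (hc : HasCompactSupport φ) :
    Integrable (fun x => u x * partialDeriv i φ x) (volume.restrict Ω) :=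
  integrable_mul_test u
    ((hφ.continuous_fderiv (by simp)).clm_apply continuous_const)
    (hc.fderiv_apply ℝ (EuclideanSpace.single i (1 : ℝ)))

theorem IsWeakPartialDeriv.add {n : ℕ} {Ω : Set (E n)} {i : Fin n} {u g u' g' : L2 Ω}
    (h : IsWeakPartialDeriv Ω i u g) (h' : IsWeakPartialDeriv Ω i u' g') :
    IsWeakPartialDeriv Ω i (u + u') (g + g') := by
  intro φ hφ hc hs
  have e1 : ∫ x in Ω, (u + u' : L2 Ω) x * partialDeriv i φ x
      = (∫ x in Ω, u x * partialDeriv i φ x) + ∫ x in Ω, u' x * partialDeriv i φ x := by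
    rw [← integral_add (integrable_mul_partialDeriv i u hφ hc)
      (integrable_mul_partialDeriv i u' hφ hc)]
    refine integral_congr_ae ?_
    filter_upwards [Lp.coeFn_add u u'] with x hx
    rw [hx, Pi.add_apply, add_mul]
  have e2 : ∫ x in Ω, (g + g' : L2 Ω) x * φ x
      = (∫ x in Ω, g x * φ x) + ∫ x in Ω, g' x * φ x := by
    rw [← integral_add (integrable_mul_test g hφ.continuous hc)
      (integrable_mul_test g' hφ.continuous hc)]
    refine integral_congr_ae ?_
    filter_upwards [Lp.coeFn_add g g'] with x hx
    rw [hx, Pi.add_apply, add_mul]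
  rw [e1, e2, h φ hφ hc hs, h' φ hφ hc hs]
  ring

theorem IsWeakPartialDeriv.smul {n : ℕ} {Ω : Set (E n)} {i : Fin n} {u g : L2 Ω} (c : ℝ)
    (h : IsWeakPartialDeriv Ω i u g) : IsWeakPartialDeriv Ω i (c • u) (c • g) := by
  intro φ hφ hc hs
  have e1 : ∫ x in Ω, (c • u : L2 Ω) x * partialDeriv i φ x
      = c * ∫ x in Ω, u x * partialDeriv i φ x := by
    rw [← integral_const_mul]
    refine integral_congr_ae ?_
    filter_upwards [Lp.coeFn_smul c u] with x hx
    rw [hx, Pi.smul_apply, smul_eq_mul, mul_assoc]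
  have e2 : ∫ x in Ω, (c • g : L2 Ω) x * φ x = c * ∫ x in Ω, g x * φ x := by
    rw [← integral_const_mul]
    refine integral_congr_ae ?_
    filter_upwards [Lp.coeFn_smul c g] with x hx
    rw [hx, Pi.smul_apply, smul_eq_mul, mul_assoc]
  rw [e1, e2, h φ hφ hc hs]
  ring

theorem isWeakPartialDeriv_zero {n : ℕ} (Ω : Set (E n)) (i : Fin n) :
    IsWeakPartialDeriv Ω i 0 0 := by
  intro φ hφ hc hs
  have e : ∀ w : E n → ℝ, ∫ x in Ω, (0 : L2 Ω) x * w x = 0 := by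
    intro w
    rw [integral_eq_zero_of_ae]
    filter_upwards [Lp.coeFn_zero ℝ 2 (volume.restrict Ω)] with x hx
    rw [hx, Pi.zero_apply, zero_mul]
  rw [e, e, neg_zero]

/-- The Sobolev space `H¹(Ω)`, realised as the subspace of those `(u, g)` in `L²(Ω) × L²(Ω)ⁿ` for
which `g` is the weak gradient of `u` (so that `g` is determined by `u`), with its usual norm
`(‖u‖² + ∑ᵢ ‖∂ᵢu‖²)^(1/2)`. -/
def H1Submodule {n : ℕ} (Ω : Set (E n)) : Submodule ℝ (L2Pair Ω) where
  carrier := {p | ∀ i, IsWeakPartialDeriv Ω i p.fst (p.snd i)}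
  add_mem' := fun hp hq i => (hp i).add (hq i)
  zero_mem' := fun i => isWeakPartialDeriv_zero Ω i
  smul_mem' := fun c _ hp i => (hp i).smul c

/-- The Sobolev space `V = H¹(Ω)`. -/
def H1 {n : ℕ} (Ω : Set (E n)) : Type := ↥(H1Submodule Ω)

instance {n : ℕ} (Ω : Set (E n)) : NormedAddCommGroup (H1 Ω) :=
  inferInstanceAs (NormedAddCommGroup ↥(H1Submodule Ω))

instance {n : ℕ} (Ω : Set (E n)) : InnerProductSpace ℝ (H1 Ω) :=
  inferInstanceAs (InnerProductSpace ℝ ↥(H1Submodule Ω))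

/-- The inclusion of `H¹(Ω)` in `L²(Ω) × L²(Ω)ⁿ`, `u ↦ (u, ∇u)`. -/
def pair {n : ℕ} (Ω : Set (E n)) : H1 Ω →ₗᵢ[ℝ] L2Pair Ω := (H1Submodule Ω).subtypeₗᵢ

/-- The embedding `H¹(Ω) → L²(Ω)`. -/
def value {n : ℕ} (Ω : Set (E n)) : H1 Ω →L[ℝ] L2 Ω :=
  LinearMap.mkContinuous
    { toFun := fun u => (pair Ω u).fst
      map_add' := fun u v => by rw [map_add]; rfl
      map_smul' := fun c u => by rw [map_smul]; rfl } 1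
    (fun u => by
      rw [one_mul, ← (pair Ω).norm_map u]
      exact WithLp.norm_fst_le _ _)

/-- The weak partial derivative `∂ᵢ : H¹(Ω) → L²(Ω)`. -/
def weakPartial {n : ℕ} (Ω : Set (E n)) (i : Fin n) : H1 Ω →L[ℝ] L2 Ω :=
  LinearMap.mkContinuous
    { toFun := fun u => (pair Ω u).snd i
      map_add' := fun u v => by rw [map_add]; rfl
      map_smul' := fun c u => by rw [map_smul]; rfl } 1
    (fun u => by
      rw [one_mul, ← (pair Ω).norm_map u]
      exact (PiLp.norm_apply_le _ i).trans (WithLp.norm_snd_le _ _))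

theorem isWeakPartialDeriv_weakPartial {n : ℕ} (Ω : Set (E n)) (i : Fin n) (u : H1 Ω) :
    IsWeakPartialDeriv Ω i (value Ω u) (weakPartial Ω i u) :=
  Subtype.property (p := fun p => p ∈ H1Submodule Ω) u i

theorem norm_sq_eq {n : ℕ} (Ω : Set (E n)) (u : H1 Ω) :
    ‖u‖ ^ 2 = ‖value Ω u‖ ^ 2 + ∑ i, ‖weakPartial Ω i u‖ ^ 2 := by
  rw [← (pair Ω).norm_map u, WithLp.prod_norm_sq_eq_of_L2, PiLp.norm_sq_eq_of_L2]
  rfl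

/-- The topological dual `V*` of `V = H¹(Ω)`, with the dual norm. -/
abbrev H1Dual {n : ℕ} (Ω : Set (E n)) : Type := H1 Ω →L[ℝ] ℝ

/-- `f ∈ L²(Ω)` as the element `v ↦ ∫_Ω f v` of `V*`. -/
def l2Functional {n : ℕ} {Ω : Set (E n)} (f : L2 Ω) : H1Dual Ω :=
  (innerSL ℝ f).comp (value Ω)

theorem l2Functional_apply {n : ℕ} {Ω : Set (E n)} (f : L2 Ω) (v : H1 Ω) :
    l2Functional f v = ∫ x in Ω, f x * value Ω v x := by
  simp [l2Functional, L2.inner_def, mul_comm]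

/-- `h ∈ L²(∂Ω)` is the boundary trace of `u ∈ H¹(Ω)`: there are smooth functions on `ℝⁿ` whose
restrictions to `Ω` converge to `u` in `H¹(Ω)` and whose restrictions to `∂Ω` converge to `h` in
`L²(∂Ω)`. On a bounded Lipschitz domain this is the graph of the usual trace operator, the unique
continuous linear map `H¹(Ω) → L²(∂Ω)` that extends restriction to `∂Ω`. -/
def HasTrace {n : ℕ} {Ω : Set (E n)} (u : H1 Ω) (h : L2Boundary Ω) : Prop :=
  ∃ φ : ℕ → E n → ℝ, (∀ m, ContDiff ℝ ∞ (φ m) ∧ HasCompactSupport (φ m)) ∧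
    Tendsto (fun m => eLpNorm (fun x => φ m x - value Ω u x) 2 (volume.restrict Ω)) atTop (𝓝 0) ∧
    (∀ i, Tendsto (fun m =>
      eLpNorm (fun x => partialDeriv i (φ m) x - weakPartial Ω i u x) 2 (volume.restrict Ω))
      atTop (𝓝 0)) ∧
    Tendsto (fun m => eLpNorm (fun x => φ m x - h x) 2 (surfaceMeasure Ω)) atTop (𝓝 0)

/-- The space `H^{1/2}(∂Ω)` of boundary traces of functions in `H¹(Ω)`. -/
def HHalfBoundary {n : ℕ} (Ω : Set (E n)) : Set (L2Boundary Ω) :=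
  {h | ∃ w : H1 Ω, HasTrace w h}

/-- `ψ ≤ h` almost everywhere on `∂Ω`, in the sense of traces. -/
def TraceLE {n : ℕ} {Ω : Set (E n)} (ψ : H1 Ω) (h : L2Boundary Ω) : Prop :=
  ∃ g : L2Boundary Ω, HasTrace ψ g ∧ ∀ᵐ x ∂(surfaceMeasure Ω), g x ≤ h x

/-- The constraint set `K = {u ∈ H¹(Ω) : u ≥ ψ in Ω, u = h on ∂Ω}`. -/
def constraintSet {n : ℕ} {Ω : Set (E n)} (ψ : H1 Ω) (h : L2Boundary Ω) : Set (H1 Ω) :=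
  {u | (∀ᵐ x ∂(volume.restrict Ω), value Ω ψ x ≤ value Ω u x) ∧ HasTrace u h}

/-- `u` solves the obstacle variational inequality: `u ∈ K` and `⟨Au - f, u - v⟩ ≤ 0` for all
`v ∈ K`. -/
def SolvesVI {n : ℕ} {Ω : Set (E n)} (A : H1 Ω → H1Dual Ω) (f : L2 Ω) (K : Set (H1 Ω))
    (u : H1 Ω) : Prop :=
  u ∈ K ∧ ∀ v ∈ K, (A u - l2Functional f) (u - v) ≤ 0

/-- The Lipschitz condition on `A` over `K`. -/
def IsLipschitzOnSet {n : ℕ} {Ω : Set (E n)} (A : H1 Ω → H1Dual Ω) (K : Set (H1 Ω)) : Prop :=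
  ∃ C_b : ℝ, 0 < C_b ∧ ∀ u ∈ K, ∀ v ∈ K, ‖A u - A v‖ ≤ C_b * ‖u - v‖

/-- The coercivity condition on `A` over `K`. -/
def IsCoerciveOnSet {n : ℕ} {Ω : Set (E n)} (A : H1 Ω → H1Dual Ω) (K : Set (H1 Ω)) : Prop :=
  ∃ C_a : ℝ, 0 < C_a ∧ ∀ u ∈ K, ∀ v ∈ K, C_a * ‖u - v‖ ^ 2 ≤ (A u - A v) (u - v)

/-- The differential operator `-Δ + ∑ᵢ bᵢ ∂ᵢ + k Id : V → V*` in weak form. -/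
def diffOperator {n : ℕ} (Ω : Set (E n)) (b : Fin n → ℝ) (k : ℝ) : H1 Ω →L[ℝ] H1Dual Ω :=
  (∑ i, (innerSL ℝ).bilinearComp (weakPartial Ω i) (weakPartial Ω i))
    + (∑ i, b i • (innerSL ℝ).bilinearComp (weakPartial Ω i) (value Ω))
    + k • (innerSL ℝ).bilinearComp (value Ω) (value Ω)

theorem diffOperator_apply {n : ℕ} (Ω : Set (E n)) (b : Fin n → ℝ) (k : ℝ) (u v : H1 Ω) :
    diffOperator Ω b k u v =
      (∑ i, ∫ x in Ω, weakPartial Ω i u x * weakPartial Ω i v x)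
      + (∑ i, b i * ∫ x in Ω, weakPartial Ω i u x * value Ω v x)
      + k * ∫ x in Ω, value Ω u x * value Ω v x := by
  have e : ∀ p q : L2 Ω, inner ℝ p q = ∫ x in Ω, p x * q x := fun p q => by
    simp only [L2.inner_def, Real.inner_apply]
  simp only [diffOperator, add_apply, sum_apply,
    smul_apply, ContinuousLinearMap.bilinearComp_apply, innerSL_apply_apply,
    smul_eq_mul, e]

/-- The differential operator satisfies the Lipschitz condition on every set, so that only
coercivity is a restriction on its coefficients. -/
theorem diffOperator_isLipschitzOnSet {n : ℕ} (Ω : Set (E n)) (b : Fin n → ℝ) (k : ℝ)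
    (K : Set (H1 Ω)) : IsLipschitzOnSet (diffOperator Ω b k) K := by
  refine ⟨‖diffOperator Ω b k‖ + 1, by positivity, fun u _ v _ => ?_⟩
  rw [← map_sub]
  refine ((diffOperator Ω b k).le_opNorm _).trans ?_
  gcongr
  linarith

/-- `L(u, v) = ⟨Au - f, u - v⟩`. -/
def lagrangian {n : ℕ} {Ω : Set (E n)} (A : H1 Ω → H1Dual Ω) (f : L2 Ω) (u v : H1 Ω) : ℝ :=
  (A u - l2Functional f) (u - v)

/-- `L_γ(u, v) = L(u, v) - ‖u - v‖² / (2γ)`. -/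
def regLagrangian {n : ℕ} {Ω : Set (E n)} (A : H1 Ω → H1Dual Ω) (f : L2 Ω) (γ : ℝ)
    (u v : H1 Ω) : ℝ :=
  lagrangian A f u v - 1 / (2 * γ) * ‖u - v‖ ^ 2

/-- The generalised regularised gap function `G_γ(u) = sup_{v ∈ S} L_γ(u, v)`, used with
`S = K ∩ Y`. The supremum is taken in the extended reals, so its finiteness is not built in. -/
def gapFunction {n : ℕ} {Ω : Set (E n)} (A : H1 Ω → H1Dual Ω) (f : L2 Ω) (γ : ℝ)
    (S : Set (H1 Ω)) (u : H1 Ω) : EReal :=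
  ⨆ v ∈ S, (regLagrangian A f γ u v : EReal)

/-- `(x, y)` is a global solution of the minmax problem `min_{x ∈ S} max_{y ∈ T} F(x, y)`:
`x ∈ S` and `y ∈ T`, `y` maximises `F(x, ·)` over `T`, and the maximum `F(x, y)` is at most
`max_{y' ∈ T} F(x', y')` for every `x' ∈ S`. -/
def IsMinmaxPoint {V : Type*} (F : V → V → ℝ) (S T : Set V) (x y : V) : Prop :=
  x ∈ S ∧ y ∈ T ∧ IsMaxOn (F x) T y ∧
    ∀ x' ∈ S, ∀ y' ∈ T, IsMaxOn (F x') T y' → F x y ≤ F x' y'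

end ObstacleVI

end

open ObstacleVI

/-! Completing the square in `v` (Riesz) turns `L_γ(u, ·)` into a constant minus a multiple of the
squared distance from `v` to one fixed point. Projection onto the closed convex set `K ∩ Y` is
therefore the unique maximiser, and `G_γ` is finite (`exists_quadratic_maximiser`). On `K ∩ X` the
choice `v = u` is admissible, so `G_γ ≥ 0`. If `G_γ(u) ≤ 0`, the penalty is of second order along
segments and disappears in the limit, leaving `⟨Au - f, u - v⟩ ≤ 0`, but only for `v ∈ K ∩ Y`. This
suffices: testing with `v = u*` and using coercivity forces `u = u*`, which solves (VI) on all of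
`K`. Since `u* ∈ K ∩ X` and `G_γ(u*) = 0`, the minimum is zero, and both minimisation statements
reduce to this characterisation of zeros. -/

namespace ObstacleVI

/-! ### Completeness of `H¹(Ω)` -/

/-- Integration of the product with a continuous compactly supported function is a continuous
functional on `L²(Ω)`. -/
theorem continuous_integral_mul {n : ℕ} {Ω : Set (E n)} {φ : E n → ℝ} (hφ : Continuous φ)
    (hc : HasCompactSupport φ) : Continuous fun u : L2 Ω => ∫ x in Ω, u x * φ x := by
  have hm : MemLp φ 2 (volume.restrict Ω) := hφ.memLp_of_hasCompactSupport hc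
  have e : (fun u : L2 Ω => ∫ x in Ω, u x * φ x) = fun u => inner ℝ (hm.toLp φ) u := by
    funext u
    rw [L2.inner_def]
    refine integral_congr_ae ?_
    filter_upwards [hm.coeFn_toLp] with x hx
    simp [hx]
  rw [e]
  exact continuous_const.inner continuous_id

/-- Each test function contributes an equation between continuous functionals of the pair.
Closedness yields the completeness needed for Riesz representation and projection. -/
theorem isClosed_H1Submodule {n : ℕ} (Ω : Set (E n)) :
    IsClosed (H1Submodule Ω : Set (L2Pair Ω)) := by
  change IsClosed {p : L2Pair Ω | ∀ i, IsWeakPartialDeriv Ω i p.fst (p.snd i)}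
  simp only [IsWeakPartialDeriv, Set.ofPred_forall]
  refine isClosed_iInter fun i => isClosed_iInter fun φ => isClosed_iInter fun hφ =>
    isClosed_iInter fun hc => isClosed_iInter fun _ => ?_
  have hd : Continuous (partialDeriv i φ) :=
    (hφ.continuous_fderiv (by simp)).clm_apply continuous_const
  refine isClosed_eq
    ((continuous_integral_mul hd (hc.fderiv_apply ℝ (EuclideanSpace.single i (1 : ℝ)))).comp ?_)
    ((continuous_integral_mul hφ.continuous hc).comp ?_).neg
  · fun_prop
  · fun_prop

instance {n : ℕ} (Ω : Set (E n)) : CompleteSpace (H1 Ω) :=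
  (isClosed_H1Submodule Ω).completeSpace_coe

/-! ### Concave quadratics on convex sets -/

/-- On a nonempty closed convex subset of a Hilbert space, `v ↦ ℓ (u - v) - c ‖u - v‖²` has a
maximiser, away from which it decays quadratically. -/
theorem exists_quadratic_maximiser {H : Type*} [NormedAddCommGroup H] [InnerProductSpace ℝ H]
    [CompleteSpace H] {C : Set H} (hne : C.Nonempty) (hconv : Convex ℝ C) (hclosed : IsClosed C)
    (ℓ : H →L[ℝ] ℝ) {c : ℝ} (hc : 0 < c) (u : H) :
    ∃ p ∈ C, ∀ v ∈ C,
      ℓ (u - v) - c * ‖u - v‖ ^ 2 + c * ‖v - p‖ ^ 2 ≤ ℓ (u - p) - c * ‖u - p‖ ^ 2 := by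
  set g : H := (InnerProductSpace.toDual ℝ H).symm ℓ with hg
  have hℓ : ∀ w, ℓ w = inner ℝ g w := fun w =>
    (InnerProductSpace.toDual_symm_apply (x := w) (y := ℓ)).symm
  -- The vertex of the quadratic; for `c = 1 / (2γ)` it is `u - γ g`.
  set z : H := u - (1 / (2 * c)) • g with hz
  obtain ⟨p, hp, hmin⟩ := exists_norm_eq_iInf_of_complete_convex hne hclosed.isComplete hconv z
  have hproj := (norm_eq_iInf_iff_real_inner_le_zero hconv hp).1 hmin
  have key : ∀ v, ℓ (u - v) - c * ‖u - v‖ ^ 2 = ‖g‖ ^ 2 / (4 * c) - c * ‖z - v‖ ^ 2 := by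
    intro v
    have e : z - v = (u - v) - (1 / (2 * c)) • g := by rw [hz]; abel
    rw [e, norm_sub_sq_real (u - v) ((1 / (2 * c)) • g), inner_smul_right, norm_smul, hℓ,
      real_inner_comm g (u - v),
      Real.norm_of_nonneg (by positivity)]
    field_simp
    ring
  refine ⟨p, hp, fun v hv => ?_⟩
  rw [key v, key p]
  have e : ‖z - v‖ ^ 2 = ‖z - p‖ ^ 2 - 2 * inner ℝ (z - p) (v - p) + ‖v - p‖ ^ 2 := by
    rw [← norm_sub_sq_real, sub_sub_sub_cancel_right]
  rw [e]
  -- The obtuse-angle inequality at the projection `p` makes the cross term favourable, so the full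
  -- `c ‖v - p‖²` survives.
  nlinarith [mul_nonneg hc.le (sub_nonneg.2 (hproj v hv))]

/-- If `u` maximises `v ↦ ℓ (u - v) - c ‖u - v‖²` over a convex set containing it, then it solves
the variational inequality for `ℓ` on that set. -/
theorem le_zero_of_quadratic_le_zero {H : Type*} [NormedAddCommGroup H] [InnerProductSpace ℝ H]
    {C : Set H} (hconv : Convex ℝ C) (ℓ : H →L[ℝ] ℝ) {c : ℝ} {u : H} (hu : u ∈ C)
    (h : ∀ v ∈ C, ℓ (u - v) - c * ‖u - v‖ ^ 2 ≤ 0) {v : H} (hv : v ∈ C) : ℓ (u - v) ≤ 0 := by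
  have hlim : Tendsto (fun t : ℝ => t * (c * ‖u - v‖ ^ 2)) (𝓝[>] 0) (𝓝 0) := by
    have : Tendsto (fun t : ℝ => t * (c * ‖u - v‖ ^ 2)) (𝓝 0) (𝓝 (0 * (c * ‖u - v‖ ^ 2))) :=
      tendsto_id.mul_const _
    rw [zero_mul] at this
    exact this.mono_left nhdsWithin_le_nhds
  refine ge_of_tendsto hlim ?_
  filter_upwards [Ioo_mem_nhdsGT (zero_lt_one' ℝ)] with t ht
  -- Testing with `u + t (v - u)` makes the linear term of order `t` and the penalty of order `t²`;
  -- dividing by `t` leaves a bound that tends to 0.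
  have e : u - (u + t • (v - u)) = t • (u - v) := by
    rw [smul_sub, smul_sub]; abel
  have := h _ (hconv.add_smul_sub_mem hu hv ⟨ht.1.le, ht.2.le⟩)
  rw [e, map_smul, norm_smul, Real.norm_of_nonneg ht.1.le, smul_eq_mul] at this
  have : t * ℓ (u - v) ≤ t * (t * (c * ‖u - v‖ ^ 2)) := by linarith
  exact le_of_mul_le_mul_left this ht.1

/-! ### The gap function -/

section Gap

variable {n : ℕ} {Ω : Set (E n)} {A : H1 Ω → H1Dual Ω} {f : L2 Ω} {γ : ℝ} {K S : Set (H1 Ω)}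

theorem regLagrangian_self (A : H1 Ω → H1Dual Ω) (f : L2 Ω) (γ : ℝ) (u : H1 Ω) :
    regLagrangian A f γ u u = 0 := by
  simp [regLagrangian, lagrangian]

theorem gapFunction_eq_of_isMaxOn {u v : H1 Ω} (hv : v ∈ S)
    (hmax : IsMaxOn (regLagrangian A f γ u) S v) :
    gapFunction A f γ S u = (regLagrangian A f γ u v : EReal) :=
  le_antisymm (iSup₂_le fun _ hw => EReal.coe_le_coe_iff.2 (hmax hw))
    (le_iSup₂ (f := fun w (_ : w ∈ S) => (regLagrangian A f γ u w : EReal)) v hv)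

theorem existsUnique_isMaxOn_regLagrangian (hne : S.Nonempty) (hconv : Convex ℝ S)
    (hclosed : IsClosed S) (hγ : 0 < γ) (u : H1 Ω) :
    ∃! v, v ∈ S ∧ IsMaxOn (regLagrangian A f γ u) S v := by
  have hc : 0 < 1 / (2 * γ) := by positivity
  obtain ⟨p, hp, hmax⟩ :=
    exists_quadratic_maximiser hne hconv hclosed (A u - l2Functional f) hc u
  refine ⟨p, ⟨hp, fun v hv => ?_⟩, fun q hq => ?_⟩
  · have : 0 ≤ 1 / (2 * γ) * ‖v - p‖ ^ 2 := by positivity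
    exact (le_add_of_nonneg_right this).trans (hmax v hv)
  -- A second maximiser has the same value as `p`, so quadratic decay leaves it at distance zero.
  · have h1 : regLagrangian A f γ u p ≤ regLagrangian A f γ u q := hq.2 hp
    have h2 : regLagrangian A f γ u q + 1 / (2 * γ) * ‖q - p‖ ^ 2 ≤ regLagrangian A f γ u p :=
      hmax q hq.1
    have h3 : ‖q - p‖ ^ 2 ≤ 0 := le_of_mul_le_mul_left (by linarith) hc
    have h4 : ‖q - p‖ = 0 := pow_eq_zero_iff two_ne_zero |>.1 (le_antisymm h3 (sq_nonneg _))
    exact sub_eq_zero.1 (norm_eq_zero.1 h4)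

theorem gapFunction_nonneg {u : H1 Ω} (hu : u ∈ S) : 0 ≤ gapFunction A f γ S u := by
  rw [← EReal.coe_zero, ← regLagrangian_self A f γ u]
  exact le_iSup₂ (f := fun w (_ : w ∈ S) => (regLagrangian A f γ u w : EReal)) u hu

theorem SolvesVI.isMaxOn_regLagrangian {u : H1 Ω} (hu : SolvesVI A f K u) (hS : S ⊆ K)
    (hγ : 0 < γ) : IsMaxOn (regLagrangian A f γ u) S u := by
  intro v hv
  change regLagrangian A f γ u v ≤ regLagrangian A f γ u u
  rw [regLagrangian_self]
  have h1 := hu.2 v (hS hv)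
  have h2 : 0 ≤ 1 / (2 * γ) * ‖u - v‖ ^ 2 := by positivity
  exact (sub_le_self _ h2).trans h1

theorem SolvesVI.gapFunction_eq_zero {u : H1 Ω} (hu : SolvesVI A f K u) (hS : S ⊆ K)
    (huS : u ∈ S) (hγ : 0 < γ) : gapFunction A f γ S u = 0 := by
  rw [gapFunction_eq_of_isMaxOn huS (hu.isMaxOn_regLagrangian hS hγ), regLagrangian_self,
    EReal.coe_zero]

/-- Coercivity leaves room for only one `u` with `⟨Au - f, u - u*⟩ ≤ 0`, where `u*` is a solution
of the variational inequality. -/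
theorem SolvesVI.eq_of_lagrangian_le_zero {u ustar : H1 Ω} (hstar : SolvesVI A f K ustar)
    (hCoer : IsCoerciveOnSet A K) (hu : u ∈ K) (h : lagrangian A f u ustar ≤ 0) : u = ustar := by
  obtain ⟨C, hC, hcoer⟩ := hCoer
  have h1 := hcoer u hu ustar hstar.1
  have h2 := hstar.2 u hu
  -- Both summands are nonpositive: the first by `h`, the second by (VI) for `ustar` tested with
  -- `u`.
  have e : (A u - A ustar) (u - ustar)
      = lagrangian A f u ustar + (A ustar - l2Functional f) (ustar - u) := by
    rw [lagrangian, ← neg_sub u ustar, map_neg]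
    simp only [sub_apply]
    ring
  have h3 : ‖u - ustar‖ ^ 2 ≤ 0 := le_of_mul_le_mul_left (by linarith) hC
  have h4 : ‖u - ustar‖ = 0 := pow_eq_zero_iff two_ne_zero |>.1 (le_antisymm h3 (sq_nonneg _))
  exact sub_eq_zero.1 (norm_eq_zero.1 h4)

theorem SolvesVI.eq_of_gapFunction_le_zero {u ustar : H1 Ω} (hstar : SolvesVI A f K ustar)
    (hCoer : IsCoerciveOnSet A K) (hS : S ⊆ K) (hconv : Convex ℝ S) (hstarS : ustar ∈ S)
    (huS : u ∈ S) (h : gapFunction A f γ S u ≤ 0) : u = ustar := by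
  refine hstar.eq_of_lagrangian_le_zero hCoer (hS huS)
    (le_zero_of_quadratic_le_zero hconv (A u - l2Functional f) (c := 1 / (2 * γ)) huS
      (fun v hv => ?_) hstarS)
  exact EReal.coe_le_coe_iff.1 ((iSup₂_le_iff.1 h) v hv)

theorem IsLipschitzOnSet.continuousOn (hLip : IsLipschitzOnSet A K) : ContinuousOn A K := by
  obtain ⟨C, hC, h⟩ := hLip
  refine (LipschitzOnWith.of_dist_le_mul (K := C.toNNReal) fun u hu v hv => ?_).continuousOn
  rw [dist_eq_norm, dist_eq_norm, Real.coe_toNNReal _ hC.le]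
  exact h u hu v hv

/-- For each fixed `v` the function `L_γ(·, v)` is continuous on `K`, and suprema of such functions
are lower semicontinuous. -/
theorem lowerSemicontinuousOn_gapFunction (hA : ContinuousOn A K) :
    LowerSemicontinuousOn (gapFunction A f γ S) K := by
  refine lowerSemicontinuousOn_iSup fun v => lowerSemicontinuousOn_iSup fun _ =>
    ContinuousOn.lowerSemicontinuousOn ?_
  refine continuous_coe_real_ereal.comp_continuousOn ?_
  unfold regLagrangian lagrangian
  exact ((hA.sub continuousOn_const).clm_apply (continuousOn_id.sub continuousOn_const)).sub
    (by fun_prop)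

end Gap

end ObstacleVI

/-! ### The equivalences -/

theorem mainTheorem2 {n : ℕ} (hn : 1 ≤ n) (Ω : Set (E n)) (hΩ : IsBoundedLipschitzDomain Ω)
    -- the obstacle `ψ`, the boundary data `h`, the source `f`
    (ψ : H1 Ω) (h : L2Boundary Ω) (hh : h ∈ HHalfBoundary Ω) (hψ : TraceLE ψ h) (f : L2 Ω)
    (K : Set (H1 Ω)) (hK : K = constraintSet ψ h)
    -- the operator `A`, Lipschitz and coercive on `K`
    (A : H1 Ω → H1Dual Ω) (hLip : IsLipschitzOnSet A K) (hCoer : IsCoerciveOnSet A K)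
    (γ : ℝ) (hγ : 0 < γ)
    -- the sets `X`, `Y`
    (ustar : H1 Ω) (hustar : SolvesVI A f K ustar)
    (X Y : Set (H1 Ω)) (hmem : ustar ∈ X ∩ Y) (hXY : K ∩ X ⊆ K ∩ Y)
    (hconv : Convex ℝ (K ∩ Y)) (hclosed : IsClosed (K ∩ Y)) :
    -- `G_γ` is finite on `H¹(Ω)`
    (∀ u : H1 Ω, gapFunction A f γ (K ∩ Y) u ≠ ⊤ ∧ gapFunction A f γ (K ∩ Y) u ≠ ⊥) ∧
    -- `G_γ` is nonnegative on `K ∩ X`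
    (∀ u ∈ K ∩ X, 0 ≤ gapFunction A f γ (K ∩ Y) u) ∧
    -- on `K ∩ X`, the zeros of `G_γ` are the solutions of the variational inequality
    (∀ u ∈ K ∩ X, gapFunction A f γ (K ∩ Y) u = 0 ↔ SolvesVI A f K u) ∧
    -- `G_γ` is lower semicontinuous on `K ∩ X`
    LowerSemicontinuousOn (gapFunction A f γ (K ∩ Y)) (K ∩ X) ∧
    -- the supremum that defines `G_γ(u)` is attained, at a unique point
    (∀ u : H1 Ω, ∃! v : H1 Ω, v ∈ K ∩ Y ∧ IsMaxOn (regLagrangian A f γ u) (K ∩ Y) v) ∧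
    (∀ u : H1 Ω, ∀ v ∈ K ∩ Y, IsMaxOn (regLagrangian A f γ u) (K ∩ Y) v →
      gapFunction A f γ (K ∩ Y) u = (regLagrangian A f γ u v : EReal)) ∧
    -- the variational inequality is equivalent to `min_{K ∩ X} G_γ`
    (∀ u : H1 Ω, SolvesVI A f K u ↔
      u ∈ K ∩ X ∧ IsMinOn (gapFunction A f γ (K ∩ Y)) (K ∩ X) u) ∧
    -- the variational inequality is equivalent to `min_{K ∩ X} max_{K ∩ Y} L_γ`
    (∀ u : H1 Ω, SolvesVI A f K u ↔
      ∃ v : H1 Ω, IsMinmaxPoint (regLagrangian A f γ) (K ∩ X) (K ∩ Y) u v) := by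
  have hSK : K ∩ Y ⊆ K := inter_subset_left
  have hstarX : ustar ∈ K ∩ X := ⟨hustar.1, hmem.1⟩
  have hstarY : ustar ∈ K ∩ Y := ⟨hustar.1, hmem.2⟩
  have hex := existsUnique_isMaxOn_regLagrangian (A := A) (f := f) ⟨ustar, hstarY⟩ hconv hclosed hγ
  have heq : ∀ u, SolvesVI A f K u → u = ustar := fun u hu =>
    hustar.eq_of_lagrangian_le_zero hCoer hu.1 (hu.2 ustar hustar.1)
  have hG0 : gapFunction A f γ (K ∩ Y) ustar = 0 := hustar.gapFunction_eq_zero hSK hstarY hγ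
  have hsol : ∀ u ∈ K ∩ X, gapFunction A f γ (K ∩ Y) u ≤ 0 → SolvesVI A f K u := by
    intro u hu h
    rw [hustar.eq_of_gapFunction_le_zero hCoer hSK hconv hstarY (hXY hu) h]
    exact hustar
  refine ⟨fun u => ?_, fun u hu => gapFunction_nonneg (hXY hu), fun u hu => ⟨fun h => hsol u hu h.le,
    fun h => ?_⟩, ?_, hex, fun u v hv hmax => gapFunction_eq_of_isMaxOn hv hmax, fun u => ⟨fun h => ?_,
    fun h => ?_⟩, fun u => ⟨fun h => ?_, ?_⟩⟩
  · obtain ⟨v, hv, hmax⟩ := (hex u).exists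
    rw [gapFunction_eq_of_isMaxOn hv hmax]
    exact ⟨EReal.coe_ne_top _, EReal.coe_ne_bot _⟩
  · exact h.gapFunction_eq_zero hSK (hXY hu) hγ
  · exact lowerSemicontinuousOn_gapFunction (hLip.continuousOn.mono inter_subset_left)
  · rw [heq u h]
    refine ⟨hstarX, fun w hw => ?_⟩
    exact hG0.trans_le (gapFunction_nonneg (hXY hw))
  · exact hsol u h.1 ((h.2 hstarX).trans_eq hG0)
  · rw [heq u h]
    refine ⟨ustar, hstarX, hstarY, hustar.isMaxOn_regLagrangian hSK hγ, fun w hw y _ hmax => ?_⟩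
    -- The value at `(ustar, ustar)` is 0, and any maximum over `K ∩ Y` is at least the diagonal
    -- value `L_γ(w, w) = 0`.
    rw [regLagrangian_self, ← regLagrangian_self A f γ w]
    exact hmax (hXY hw)
  · rintro ⟨v, hu, hv, hmax, hmin⟩
    refine hsol u hu ?_
    -- Comparison with the competitor `ustar`, whose maximum is 0 and is attained at `ustar`, gives
    -- `G_γ(u) ≤ 0`.
    rw [gapFunction_eq_of_isMaxOn hv hmax, ← EReal.coe_zero, EReal.coe_le_coe_iff,
      ← regLagrangian_self A f γ ustar]
    exact hmin ustar hstarX ustar hstarY (hustar.isMaxOn_regLagrangian hSK hγ)
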